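/- Let $E$ be a complex Hilbert space and let $H_s$, $W_s$, $\rho_s(0)$ be bounded linear operators on $E$, with $H_s$ and $W_s$ Hermitian (self-adjoint); $\|\cdot\|$ is the operator norm. Let $B:\mathbb R\times\mathbb R\to\mathbb C$ satisfy $|B(\tau_1,\tau_2)|\le\bar B$ for all $\tau_1,\tau_2$, and suppose that for all nonzero $\tau_1,\tau_2$ the partial derivatives of $B$ exist and $|\partial_{\tau_1}B(\tau_1,\tau_2)|+|\partial_{\tau_2}B(\tau_1,\tau_2)|\le\bar B'$. For a finite sequence of times put $$\mathcal L_b(\tau_1,\dots,\tau_k)=\sum_{\mathfrak q}\ \prod_{(i,j)\in\mathfrak q,\ i<j}B(\tau_i,\tau_j),$$ where $\mathfrak q$ runs over all partitions of $\{1,\dots,k\}$ into pairs (so $\mathcal L_b=1$ for $k=0$ and $\mathcal L_b=0$ for odd $k$). For $t\ge 0$ define $$\rho_s(t)=\sum_{m=0}^{\infty}\sum_{m'=0}^{\infty}(-\mathrm i)^m\,\mathrm i^{m'}\!\!\int_{0<t_1<\dots<t_m<t}\int_{0<t_1'<\dots<t'_{m'}<t}\mathrm e^{-\mathrm iH_s(t-t_m)}W_s\,\mathrm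 e^{-\mathrm iH_s(t_m-t_{m-1})}W_s\cdots W_s\,\mathrm e^{-\mathrm iH_st_1}\,\rho_s(0)\,\mathrm e^{\mathrm iH_st_1'}W_s\cdots W_s\,\mathrm e^{\mathrm iH_s(t-t'_{m'})}\,\mathcal L_b(-t_m,\dots,-t_1,t_1',\dots,t'_{m'})\,\mathrm dt'\,\mathrm dt .$$ For $\Delta t>0$ let $\mathcal P_0=\mathrm e^{-\mathrm iH_s\Delta t}$ and $\mathcal P_1=-\mathrm i\Delta t\,\mathrm e^{-\mathrm iH_s\Delta t/2}W_s\,\mathrm e^{-\mathrm iH_s\Delta t/2}$, and for $n\ge 0$ let $$\rho_{s,n}=\sum_{j^-,\,j^+\in\{0,1\}^n}\mathcal P_{j^-_n}\cdots\mathcal P_{j^-_1}\,\rho_s(0)\,\mathcal P_{j^+_1}^\dagger\cdots\mathcal P_{j^+_n}^\dagger\ \mathcal L_b\big(-(k^-_{m_-}-\tfrac12)\Delta t,\dots,-(k^-_1-\tfrac12)\Delta t,\,(k^+_1-\tfrac12)\Delta t,\dots,(k^+_{m_+}-\tfrac12)\Delta t\big),$$ where $k^\pm_1<\dots<k^\pm_{m_\pm}$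 are the indices $k$ with $j^\pm_k=1$. Then all the integrals in the definition of $\rho_s(n\Delta t)$ converge absolutely, the double series for $\rho_s(n\Delta t)$ converges (unconditionally), and there is a constant $C$ depending only on $\|H_s\|$, $\|\rho_s(0)\|$, $\|W_s\|$, $\bar B$, $\bar B'$ and $T=n\Delta t$ such that $$\|\rho_{s,n}-\rho_s(n\Delta t)\|\le C\,\Delta t .$$ -/

import Mathlib

open MeasureTheory

noncomputable section

namespace OpenDyson

/-- The pairings of `{0, …, k-1}`, encoded as the involutions without fixed points:
`i` is paired with `σ i`. For `k = 0` there is exactly one (the empty pairing), and for odd `k`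
there is none. -/
def pairings (k : ℕ) : Finset (Equiv.Perm (Fin k)) :=
  Finset.univ.filter fun σ => ∀ i, σ (σ i) = i ∧ σ i ≠ i

/-- The sum over all pairings of the times `τ 0, τ 1, …, τ (k-1)` of the product of `B` over the
pairs; in each pair the time that comes first in the sequence is the first argument of `B`. -/
def pairingSum (B : ℝ → ℝ → ℂ) {k : ℕ} (τ : Fin k → ℝ) : ℂ :=
  ∑ σ ∈ pairings k, ∏ i ∈ Finset.univ.filter (fun i => i < σ i), B (τ i) (τ (σ i))

/-- The bath influence functional `𝓛_b(-t_m, …, -t_1; t'_1, …, t'_{m'})`. -/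
def influence (B : ℝ → ℝ → ℂ) {m m' : ℕ} (t : Fin m → ℝ) (t' : Fin m' → ℝ) : ℂ :=
  pairingSum B (Fin.append (fun i => -t i.rev) t')

/-- The simplex `0 < s_1 < s_2 < ⋯ < s_m < t`. -/
def simplex (m : ℕ) (t : ℝ) : Set (Fin m → ℝ) :=
  {s | StrictMono s ∧ ∀ i, s i ∈ Set.Ioo 0 t}

section Operators

variable {E : Type*} [NormedAddCommGroup E] [InnerProductSpace ℂ E] [CompleteSpace E]

/-- The free propagator `exp (-i H t)`. -/
def freeProp (H : E →L[ℂ] E) (t : ℝ) : E →L[ℂ] E :=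
  NormedSpace.exp ((-(Complex.I * (t : ℂ))) • H)

/-- `exp (-i H (t - t_m)) W exp (-i H (t_m - t_{m-1})) W ⋯ W exp (-i H t_1)`. -/
def leftChain (H W : E →L[ℂ] E) : (m : ℕ) → ℝ → (Fin m → ℝ) → (E →L[ℂ] E)
  | 0, t, _ => freeProp H t
  | m + 1, t, s =>
      freeProp H (t - s (Fin.last m)) * W * leftChain H W m (s (Fin.last m)) (Fin.init s)

/-- `exp (i H t'_1) W exp (i H (t'_2 - t'_1)) W ⋯ W exp (i H (t - t'_{m'}))`. -/
def rightChain (H W : E →L[ℂ] E) : (m : ℕ) → ℝ → (Fin m → ℝ) → (E →L[ℂ] E)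
  | 0, t, _ => freeProp H (-t)
  | m + 1, t, s =>
      rightChain H W m (s (Fin.last m)) (Fin.init s) * W * freeProp H (-(t - s (Fin.last m)))

/-- The integrand of the `(m, m')` term of the Dyson series for the reduced density matrix. -/
def dysonIntegrand (H W ρ₀ : E →L[ℂ] E) (B : ℝ → ℝ → ℂ) (t : ℝ) (m m' : ℕ)
    (p : (Fin m → ℝ) × (Fin m' → ℝ)) : E →L[ℂ] E :=
  influence B p.1 p.2 • (leftChain H W m t p.1 * ρ₀ * rightChain H W m' t p.2)

/-- The `(m, m')` term of the Dyson series for the reduced density matrix at time `t`. -/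
def dysonTerm (H W ρ₀ : E →L[ℂ] E) (B : ℝ → ℝ → ℂ) (t : ℝ) (m m' : ℕ) : E →L[ℂ] E :=
  ((-Complex.I) ^ m * Complex.I ^ m') •
    ∫ p in simplex m t ×ˢ simplex m' t, dysonIntegrand H W ρ₀ B t m m' p

/-- The reduced density matrix `ρ_s(t)`. -/
def reducedDensity (H W ρ₀ : E →L[ℂ] E) (B : ℝ → ℝ → ℂ) (t : ℝ) : E →L[ℂ] E :=
  ∑' m : ℕ, ∑' m' : ℕ, dysonTerm H W ρ₀ B t m m'

/-- The one-step operators `𝓟_{s,0} = exp (-i H Δt)` and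
`𝓟_{s,1} = -i Δt exp (-i H Δt / 2) W exp (-i H Δt / 2)`. -/
def stepOp (H W : E →L[ℂ] E) (Δt : ℝ) (j : Fin 2) : E →L[ℂ] E :=
  if j = 0 then freeProp H Δt
  else (-(Complex.I * (Δt : ℂ))) • (freeProp H (Δt / 2) * W * freeProp H (Δt / 2))

/-- The positions of the ones in the sequence `j`, counted from zero. -/
def ones {n : ℕ} (j : Fin n → Fin 2) : Finset (Fin n) :=
  Finset.univ.filter fun k => j k = 1

/-- The midpoints of the time steps in which `j` is one, in increasing order. The step with
zero-based index `k` is `[k Δt, (k + 1) Δt]`. -/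
def midTimes {n : ℕ} (Δt : ℝ) (j : Fin n → Fin 2) (a : Fin (ones j).card) : ℝ :=
  ((((ones j).orderEmbOfFin rfl a : Fin n) : ℕ) + 1 / 2 : ℝ) * Δt

/-- The first-order discrete Dyson approximation `ρ_{s,n}`. -/
def discreteDensity (H W ρ₀ : E →L[ℂ] E) (B : ℝ → ℝ → ℂ) (Δt : ℝ) (n : ℕ) : E →L[ℂ] E :=
  ∑ jm : Fin n → Fin 2, ∑ jp : Fin n → Fin 2,
    influence B (midTimes Δt jm) (midTimes Δt jp) •
      ((List.ofFn fun k => stepOp H W Δt (jm k)).reverse.prod * ρ₀ *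
        (List.ofFn fun k => star (stepOp H W Δt (jp k))).prod)

end Operators

/-- `B` is bounded by `b`, and away from the axes its partial derivatives exist and the sum of
their absolute values is bounded by `b'`. -/
structure IsBoundedCorrelation (B : ℝ → ℝ → ℂ) (b b' : ℝ) : Prop where
  bound : ∀ τ₁ τ₂, ‖B τ₁ τ₂‖ ≤ b
  diff_left : ∀ τ₁ τ₂, τ₁ ≠ 0 → τ₂ ≠ 0 → DifferentiableAt ℝ (fun s => B s τ₂) τ₁
  diff_right : ∀ τ₁ τ₂, τ₁ ≠ 0 → τ₂ ≠ 0 → DifferentiableAt ℝ (fun s => B τ₁ s) τ₂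
  deriv_bound : ∀ τ₁ τ₂, τ₁ ≠ 0 → τ₂ ≠ 0 →
    ‖deriv (fun s => B s τ₂) τ₁‖ + ‖deriv (fun s => B τ₁ s) τ₂‖ ≤ b'

end OpenDyson

end

open OpenDyson

open MeasureTheory

noncomputable section

namespace OpenDyson

/-! ### The free propagator and the Dyson chains. -/

section Operators

variable {E : Type*} [NormedAddCommGroup E] [InnerProductSpace ℂ E] [CompleteSpace E]

/-! The discrete density is a midpoint Riemann sum for the Dyson series, term by term. A product of
one-step operators with `m` coupled steps is `(-iΔt)^m` times the chain through the midpoints of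
those steps (`prod_stepOp_eq`). Grouping by the numbers `m`, `m'` of coupled steps on the two sides
turns `discreteDensity` into a sum over cells, products of distinct time steps, each weighted by its
volume `Δt ^ (m + m')` (`discreteDensity_eq_sum`).

Two errors arise in each term. Inside the cells the integrand is Lipschitz
(`norm_dysonIntegrand_sub_le`): left times enter `B` negated and right times as they are, so no
argument of `B` crosses the axes, where differentiability may fail. The part of the domain outside
the cells has volume `O(Δt)` (`volume_sub_cells_le`), since few index tuples have a repetition.

These errors must be summable in `(m, m')`. There are at most `√(k!)` pairings of `k` points
(`card_pairings_sq_le`), while the simplices have volumes of order `1 / m!` and `1 / m'!`. As `(m +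
m')! ≤ 2 ^ (m + m') m! m'!`, what remains is bounded by a product of series `∑ K ^ m / √(m!)`. The
factors polynomial in `m + m'` are absorbed into `K` (`norm_discreteTerm_sub_dysonTerm_le`). -/

theorem freeProp_add (H : E →L[ℂ] E) (s t : ℝ) :
    freeProp H (s + t) = freeProp H s * freeProp H t := by
  let _ : NormedAlgebra ℚ (E →L[ℂ] E) := NormedAlgebra.restrictScalars ℚ ℂ (E →L[ℂ] E)
  unfold freeProp
  rw [← NormedSpace.exp_add_of_commute]
  · rw [← add_smul]; congr 2; push_cast; ring
  · exact ((Commute.refl H).smul_left _).smul_right _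

theorem freeProp_zero (H : E →L[ℂ] E) : freeProp H 0 = 1 := by
  simp [freeProp]

theorem star_freeProp {H : E →L[ℂ] E} (hH : IsSelfAdjoint H) (t : ℝ) :
    star (freeProp H t) = freeProp H (-t) := by
  unfold freeProp
  rw [NormedSpace.star_exp, star_smul, hH.star_eq]
  congr 2
  simp

/-- Unitarity and the C⋆-identity. Equality fails when `E` is trivial. -/
theorem norm_freeProp_le {H : E →L[ℂ] E} (hH : IsSelfAdjoint H) (t : ℝ) :
    ‖freeProp H t‖ ≤ 1 := by
  have h1 : ‖freeProp H t‖ * ‖freeProp H t‖ ≤ 1 := by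
    rw [← CStarRing.norm_star_mul_self, star_freeProp hH, ← freeProp_add, neg_add_cancel,
      freeProp_zero]
    exact ContinuousLinearMap.norm_id_le
  nlinarith [norm_nonneg (freeProp H t)]

theorem hasDerivAt_freeProp (H : E →L[ℂ] E) (t : ℝ) :
    HasDerivAt (freeProp H) (freeProp H t * ((-Complex.I) • H)) t := by
  have h := hasDerivAt_exp_smul_const (𝕂 := ℝ) ((-Complex.I) • H) t
  have e : freeProp H = fun u : ℝ => NormedSpace.exp (u • ((-Complex.I) • H)) := by
    funext u
    unfold freeProp
    congr 1
    ext x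
    simp [mul_smul, smul_comm u]
  rw [e]
  exact h

theorem norm_freeProp_sub_le {H : E →L[ℂ] E} (hH : IsSelfAdjoint H) (s t : ℝ) :
    ‖freeProp H s - freeProp H t‖ ≤ ‖H‖ * |s - t| := by
  refine Convex.norm_image_sub_le_of_norm_hasDerivWithin_le (s := Set.univ)
    (fun x _ => (hasDerivAt_freeProp H x).hasDerivWithinAt) (fun x _ => ?_) convex_univ
    (Set.mem_univ t) (Set.mem_univ s)
  calc _ ≤ ‖freeProp H x‖ * ‖(-Complex.I) • H‖ := norm_mul_le _ _
    _ ≤ 1 * ‖(-Complex.I) • H‖ := by gcongr; exact norm_freeProp_le hH x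
    _ = ‖H‖ := by simp [norm_smul]

theorem norm_leftChain_le {H : E →L[ℂ] E} (hH : IsSelfAdjoint H) (W : E →L[ℂ] E) (m : ℕ) (t : ℝ)
    (s : Fin m → ℝ) : ‖leftChain H W m t s‖ ≤ ‖W‖ ^ m := by
  induction m generalizing t with
  | zero => simpa [leftChain] using norm_freeProp_le hH t
  | succ m ih =>
    rw [leftChain, pow_succ']
    refine (norm_mul_le _ _).trans (mul_le_mul ((norm_mul_le _ _).trans ?_) (ih _ _)
      (norm_nonneg _) (norm_nonneg _))
    exact mul_le_of_le_one_left (norm_nonneg _) (norm_freeProp_le hH _)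

theorem norm_mul_sub_mul_le {R : Type*} [NormedRing R] (a b c d : R) :
    ‖a * b - c * d‖ ≤ ‖a - c‖ * ‖b‖ + ‖c‖ * ‖b - d‖ := by
  have : a * b - c * d = (a - c) * b + c * (b - d) := by noncomm_ring
  rw [this]
  exact (norm_add_le _ _).trans (add_le_add (norm_mul_le _ _) (norm_mul_le _ _))

/-- The chain is Lipschitz in its final and intermediate times jointly. -/
theorem norm_leftChain_sub_le {H : E →L[ℂ] E} (hH : IsSelfAdjoint H) (W : E →L[ℂ] E) (m : ℕ)
    {δ t t' : ℝ} {s s' : Fin m → ℝ} (ht : |t - t'| ≤ δ) (hs : ∀ i, |s i - s' i| ≤ δ) :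
    ‖leftChain H W m t s - leftChain H W m t' s'‖ ≤ ‖W‖ ^ m * (‖H‖ * (2 * m + 1) * δ) := by
  have hδ : 0 ≤ δ := (abs_nonneg _).trans ht
  induction m generalizing t t' with
  | zero =>
    simp only [leftChain, pow_zero, one_mul, Nat.cast_zero, mul_zero, zero_add, mul_one]
    exact (norm_freeProp_sub_le hH t t').trans (by gcongr)
  | succ m ih =>
    have hl := hs (Fin.last m)
    simp only [leftChain]
    refine (norm_mul_sub_mul_le _ _ _ _).trans ?_
    have h1 : ‖freeProp H (t - s (Fin.last m)) * W - freeProp H (t' - s' (Fin.last m)) * W‖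
        ≤ ‖H‖ * (2 * δ) * ‖W‖ := by
      rw [← sub_mul]
      refine (norm_mul_le _ _).trans ?_
      gcongr
      refine (norm_freeProp_sub_le hH _ _).trans ?_
      gcongr
      rw [abs_le] at *
      constructor <;> linarith
    have h2 : ‖freeProp H (t' - s' (Fin.last m)) * W‖ ≤ ‖W‖ :=
      (norm_mul_le _ _).trans (mul_le_of_le_one_left (norm_nonneg _) (norm_freeProp_le hH _))
    have h3 := ih (s := Fin.init s) (s' := Fin.init s') hl (fun i => hs _)
    calc _ ≤ ‖H‖ * (2 * δ) * ‖W‖ * ‖W‖ ^ m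
          + ‖W‖ * (‖W‖ ^ m * (‖H‖ * (2 * m + 1) * δ)) := by
          gcongr; exact norm_leftChain_le hH W m _ _
      _ = _ := by push_cast; ring

/-- Transfers every estimate for left chains to right chains. -/
theorem rightChain_eq_star {H W : E →L[ℂ] E} (hH : IsSelfAdjoint H) (hW : IsSelfAdjoint W)
    (m : ℕ) (t : ℝ) (s : Fin m → ℝ) : rightChain H W m t s = star (leftChain H W m t s) := by
  induction m generalizing t with
  | zero => simp [rightChain, leftChain, star_freeProp hH]
  | succ m ih =>
    simp only [rightChain, leftChain, star_mul, star_freeProp hH, hW.star_eq, ih, mul_assoc]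

/-! ### Products of one-step operators as chains. -/

theorem freeProp_mul_leftChain (H W : E →L[ℂ] E) (m : ℕ) (u t : ℝ) (s : Fin m → ℝ) :
    freeProp H u * leftChain H W m t s = leftChain H W m (u + t) s := by
  cases m with
  | zero => simp [leftChain, freeProp_add]
  | succ m => simp only [leftChain, ← mul_assoc, ← freeProp_add, add_sub_assoc]

/-- The ordered product of the one-step operators is a chain through the midpoints of the steps
that carry a coupling operator. -/
theorem prod_stepOp_eq (H W : E →L[ℂ] E) (Δt : ℝ) (n : ℕ) (j : ℕ → Fin 2) (m : ℕ) (κ : Fin m → ℕ)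
    (hκ : StrictMono κ) (hlt : ∀ a, κ a < n) (hj : ∀ k < n, j k = 1 ↔ ∃ a, κ a = k) :
    (List.ofFn fun k : Fin n => stepOp H W Δt (j k)).reverse.prod =
      (-(Complex.I * (Δt : ℂ))) ^ m •
        leftChain H W m (n * Δt) (fun a => ((κ a : ℝ) + 1 / 2) * Δt) := by
  induction n generalizing m with
  | zero =>
    obtain rfl : m = 0 := by
      by_contra h
      exact absurd (hlt ⟨0, Nat.pos_of_ne_zero h⟩) (Nat.not_lt_zero _)
    simp [leftChain, freeProp_zero]
  | succ n ih =>
    rw [List.ofFn_succ', List.concat_eq_append, List.reverse_append, List.prod_append]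
    simp only [List.reverse_singleton, List.prod_singleton, Fin.val_castSucc, Fin.val_last]
    by_cases h : j n = 1
    · obtain ⟨a, ha⟩ := (hj n n.lt_succ_self).1 h
      obtain ⟨m, rfl⟩ : ∃ m', m = m' + 1 := ⟨m - 1, by have := a.2; omega⟩
      have hlast : κ (Fin.last m) = n := by
        have h1 := hκ.monotone (Fin.le_last a)
        have h2 := hlt (Fin.last m)
        omega
      have hinit : ∀ i : Fin m, κ i.castSucc < n := fun i => by
        rw [← hlast]; exact hκ (Fin.castSucc_lt_last i)
      rw [ih m (fun i => κ i.castSucc) (fun i i' hi => hκ (Fin.castSucc_lt_castSucc_iff.2 hi))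
        hinit]
      -- The coupling sits at the midpoint of the last step: one half-step follows it, the other is
      -- merged into the preceding chain.
      · have e1 : ((n + 1 : ℕ) : ℝ) * Δt - ((n : ℝ) + 1 / 2) * Δt = Δt / 2 := by push_cast; ring
        have e2 : ((n : ℝ) + 1 / 2) * Δt = Δt / 2 + n * Δt := by ring
        simp only [stepOp, h, leftChain, hlast, e1, one_ne_zero, if_false]
        rw [e2, ← freeProp_mul_leftChain]
        simp only [smul_mul_smul_comm, ← pow_succ', mul_assoc]
        rfl
      · intro k hk
        rw [hj k (by omega)]
        constructor
        · rintro ⟨a, rfl⟩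
          obtain ⟨i, rfl⟩ | rfl := a.eq_castSucc_or_eq_last
          · exact ⟨i, rfl⟩
          · omega
        · rintro ⟨a, rfl⟩; exact ⟨_, rfl⟩
    -- An uncoupled step only prolongs the final free evolution.
    · have hne : ∀ a, κ a ≠ n := fun a ha => h ((hj n n.lt_succ_self).2 ⟨a, ha⟩)
      rw [ih m κ hκ (fun a => by have := hlt a; have := hne a; omega)
        (fun k hk => hj k (by omega))]
      have h0 : j n = 0 := by omega
      simp only [stepOp, h0, if_true]
      rw [mul_smul_comm, freeProp_mul_leftChain]
      congr 2
      push_cast; ring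

/-- The midpoints of the time steps with index in `S`, in increasing order. -/
def stepMid {n m : ℕ} (Δt : ℝ) (S : Finset (Fin n)) (h : S.card = m) (a : Fin m) : ℝ :=
  ((S.orderEmbOfFin h a : ℕ) + 1 / 2 : ℝ) * Δt

theorem prod_stepOp_eq_leftChain (H W : E →L[ℂ] E) (Δt : ℝ) {n : ℕ} (j : Fin n → Fin 2) :
    (List.ofFn fun k => stepOp H W Δt (j k)).reverse.prod =
      (-(Complex.I * (Δt : ℂ))) ^ (ones j).card •
        leftChain H W (ones j).card (n * Δt) (stepMid Δt (ones j) rfl) := by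
  have := prod_stepOp_eq H W Δt n (fun k => if h : k < n then j ⟨k, h⟩ else 0) (ones j).card
    (fun a => ((ones j).orderEmbOfFin rfl a : Fin n)) (fun a b hab => by simpa using hab)
    (fun a => Fin.is_lt _) (fun k hk => by
      have hr := Finset.range_orderEmbOfFin (ones j) rfl
      have : (⟨k, hk⟩ : Fin n) ∈ ones j ↔ ∃ a, (ones j).orderEmbOfFin rfl a = ⟨k, hk⟩ := by
        rw [← Finset.mem_coe, ← hr]; rfl
      simp only [hk, dif_pos]
      simpa [ones, Fin.ext_iff] using this)
  simp only [Fin.is_lt, dif_pos, Fin.eta] at this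
  exact this

theorem star_prod_reverse {R : Type*} [Monoid R] [StarMul R] (l : List R) :
    star l.reverse.prod = (l.map star).prod := by
  induction l with
  | nil => simp
  | cons a l ih => simp [ih]

theorem prod_star_stepOp_eq_rightChain {H W : E →L[ℂ] E} (hH : IsSelfAdjoint H)
    (hW : IsSelfAdjoint W) (Δt : ℝ) {n : ℕ} (j : Fin n → Fin 2) :
    (List.ofFn fun k => star (stepOp H W Δt (j k))).prod =
      (Complex.I * (Δt : ℂ)) ^ (ones j).card •
        rightChain H W (ones j).card (n * Δt) (stepMid Δt (ones j) rfl) := by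
  have h := congrArg star (prod_stepOp_eq_leftChain H W Δt j)
  rw [star_smul, ← rightChain_eq_star hH hW, star_prod_reverse, List.map_ofFn] at h
  have hc : star ((-(Complex.I * (Δt : ℂ))) ^ (ones j).card) =
      (Complex.I * (Δt : ℂ)) ^ (ones j).card := by simp
  rw [hc] at h
  exact h

end Operators

/-! ### Counting pairings. -/

theorem cycleType_of_mem_pairings {k : ℕ} {σ : Equiv.Perm (Fin k)} (hσ : σ ∈ pairings k) :
    ∃ p, k = 2 * p ∧ σ.cycleType = Multiset.replicate p 2 := by
  simp only [pairings, Finset.mem_filter, Finset.mem_univ, true_and] at hσ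
  have hsq : σ ^ 2 = 1 := by
    ext i
    simp [sq, (hσ i).1]
  have hc := Equiv.Perm.cycleType_of_pow_prime_eq_one (p := 2) hsq
  have hsupp : σ.support = Finset.univ := by
    ext i
    simpa using (hσ i).2
  have hsum := σ.sum_cycleType
  rw [hsupp, hc, Multiset.sum_replicate, Finset.card_univ, Fintype.card_fin, smul_eq_mul] at hsum
  exact ⟨_, by omega, hc⟩

/-- Pairings lie in a single conjugacy class, that of `p` disjoint transpositions, whose centralizer
has order `2 ^ p * p!`. -/
theorem card_pairings_two_mul_le (p : ℕ) :
    (pairings (2 * p)).card * (2 ^ p * p.factorial) ≤ (2 * p).factorial := by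
  have h := Equiv.Perm.card_of_cycleType_mul_eq (Fin (2 * p)) (Multiset.replicate p 2)
  have hsub : pairings (2 * p) ⊆
      Finset.univ.filter fun g => g.cycleType = Multiset.replicate p 2 := by
    intro σ hσ
    obtain ⟨q, hq, hc⟩ := cycleType_of_mem_pairings hσ
    obtain rfl : p = q := by omega
    simpa using hc
  refine (Nat.mul_le_mul (Finset.card_le_card hsub) ?_).trans (h.trans_le ?_)
  · rcases p with _ | p
    · simp
    · rw [Multiset.toFinset_replicate, if_neg p.succ_ne_zero, Finset.prod_singleton,
        Multiset.count_replicate_self, Multiset.prod_replicate]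
      exact Nat.mul_le_mul_right _ (Nat.le_mul_of_pos_left _ (Nat.factorial_pos _))
  · split_ifs <;> simp

/-- For `k = 2p`, the central binomial coefficient is at most `4 ^ p`, so `(2p)! ≤ (2 ^ p * p!) ^
2`; combine this with the square of the preceding count. -/
theorem card_pairings_sq_le (k : ℕ) : (pairings k).card ^ 2 ≤ k.factorial := by
  by_cases hk : 2 ∣ k
  · obtain ⟨p, rfl⟩ := hk
    have h := card_pairings_two_mul_le p
    have h1 : (2 * p).factorial = p.centralBinom * (p.factorial * p.factorial) := by
      rw [Nat.centralBinom, ← Nat.choose_mul_factorial_mul_factorial (show p ≤ 2 * p by omega)]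
      rw [show 2 * p - p = p by omega]; ring
    have h2 : p.centralBinom ≤ 4 ^ p := by
      have := Nat.sum_range_choose (2 * p)
      have h3 := Finset.single_le_sum (f := fun i => (2 * p).choose i) (fun i _ => Nat.zero_le _)
        (show p ∈ Finset.range (2 * p + 1) by simp; omega)
      rw [this, pow_mul] at h3
      exact h3
    have h4 : (2 * p).factorial ≤ (2 ^ p * p.factorial) ^ 2 := by
      rw [h1, mul_pow, ← pow_mul, mul_comm p 2, pow_mul, sq p.factorial]
      exact Nat.mul_le_mul_right _ h2
    have h5 : (pairings (2 * p)).card ^ 2 * (2 * p).factorial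
        ≤ (2 * p).factorial * (2 * p).factorial :=
      (Nat.mul_le_mul_left _ h4).trans (by
        rw [← mul_pow, ← sq]; exact Nat.pow_le_pow_left h 2)
    exact Nat.le_of_mul_le_mul_right h5 (Nat.factorial_pos _)
  · rw [Finset.card_eq_zero.2, zero_pow two_ne_zero]
    · exact Nat.zero_le _
    · refine Finset.eq_empty_of_forall_notMem fun σ hσ => ?_
      obtain ⟨p, hp, -⟩ := cycleType_of_mem_pairings hσ
      exact hk ⟨p, hp⟩

/-! ### Bounds and Lipschitz estimates for the influence functional. -/

/-- The positive products keep each coordinate in one open half-line, which is convex and avoids the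
axes, so the mean value inequality applies to one argument at a time. -/
theorem norm_sub_le_of_pos_mul {B : ℝ → ℝ → ℂ} {b b' : ℝ} (hB : IsBoundedCorrelation B b b')
    {x x' y y' δ : ℝ} (hx : 0 < x * x') (hy : 0 < y * y') (hxδ : |x - x'| ≤ δ)
    (hyδ : |y - y'| ≤ δ) : ‖B x y - B x' y'‖ ≤ 2 * b' * δ := by
  have key : ∀ {f : ℝ → ℂ} {u v : ℝ}, 0 < u * v →
      (∀ w ≠ 0, DifferentiableAt ℝ f w) → (∀ w ≠ 0, ‖deriv f w‖ ≤ b') → |u - v| ≤ δ →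
      0 ≤ b' → ‖f u - f v‖ ≤ b' * δ := by
    intro f u v huv hd hb hδ hb'
    have hle : ‖f u - f v‖ ≤ b' * ‖u - v‖ := by
      rcases mul_pos_iff.1 huv with ⟨hu, hv⟩ | ⟨hu, hv⟩
      · exact Convex.norm_image_sub_le_of_norm_deriv_le (s := Set.Ioi 0)
          (fun w hw => hd w (ne_of_gt hw)) (fun w hw => hb w (ne_of_gt hw)) (convex_Ioi 0) hv hu
      · exact Convex.norm_image_sub_le_of_norm_deriv_le (s := Set.Iio 0)
          (fun w hw => hd w (ne_of_lt hw)) (fun w hw => hb w (ne_of_lt hw)) (convex_Iio 0) hv hu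
    exact hle.trans (by gcongr; exact hδ)
  have hb' : 0 ≤ b' := le_trans (by positivity) (hB.deriv_bound 1 1 one_ne_zero one_ne_zero)
  have hy0 : y ≠ 0 := fun h => by simp [h] at hy
  have hx0 : x' ≠ 0 := fun h => by simp [h] at hx
  have h1 := key (f := fun s => B s y) hx (fun w hw => hB.diff_left w y hw hy0)
    (fun w hw => (le_add_of_nonneg_right (norm_nonneg _)).trans (hB.deriv_bound w y hw hy0))
    hxδ hb'
  have h2 := key (f := fun s => B x' s) hy (fun w hw => hB.diff_right x' w hx0 hw)
    (fun w hw => (le_add_of_nonneg_left (norm_nonneg _)).trans (hB.deriv_bound x' w hx0 hw))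
    hyδ hb'
  calc ‖B x y - B x' y'‖ ≤ ‖B x y - B x' y‖ + ‖B x' y - B x' y'‖ :=
        norm_sub_le_norm_sub_add_norm_sub _ _ _
    _ ≤ 2 * b' * δ := by linarith

theorem norm_prod_le_pow {ι : Type*} (s : Finset ι) (f : ι → ℂ) {β : ℝ}
    (hf : ∀ i ∈ s, ‖f i‖ ≤ β) : ‖∏ i ∈ s, f i‖ ≤ β ^ s.card := by
  rw [norm_prod]
  exact (Finset.prod_le_prod (fun i _ => norm_nonneg _) hf).trans_eq (Finset.prod_const _)

/-- Replace the factors one at a time; `1 ≤ β` allows the exponent to be rounded up to `s.card`. -/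
theorem norm_prod_sub_prod_le {ι : Type*} (s : Finset ι) (f g : ι → ℂ) {β η : ℝ} (hβ : 1 ≤ β)
    (hf : ∀ i ∈ s, ‖f i‖ ≤ β) (hg : ∀ i ∈ s, ‖g i‖ ≤ β) (hfg : ∀ i ∈ s, ‖f i - g i‖ ≤ η) :
    ‖∏ i ∈ s, f i - ∏ i ∈ s, g i‖ ≤ s.card * β ^ s.card * η := by
  classical
  induction s using Finset.induction_on with
  | empty => simp
  | insert a s ha ih =>
    rw [Finset.prod_insert ha, Finset.prod_insert ha, Finset.card_insert_of_notMem ha]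
    refine (norm_mul_sub_mul_le _ _ _ _).trans ?_
    have h1 := ih (fun i hi => hf i (Finset.mem_insert_of_mem hi))
      (fun i hi => hg i (Finset.mem_insert_of_mem hi))
      (fun i hi => hfg i (Finset.mem_insert_of_mem hi))
    have h2 := norm_prod_le_pow s f (fun i hi => hf i (Finset.mem_insert_of_mem hi))
    have h3 := hfg a (Finset.mem_insert_self _ _)
    have h4 := hg a (Finset.mem_insert_self _ _)
    have hη : 0 ≤ η := (norm_nonneg _).trans h3
    calc _ ≤ η * β ^ s.card + β * (s.card * β ^ s.card * η) := by gcongr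
      _ ≤ η * β ^ (s.card + 1) + β * (s.card * β ^ s.card * η) := by
        gcongr
        omega
      _ = _ := by push_cast; ring

section Influence

variable {B : ℝ → ℝ → ℂ} {b b' : ℝ}

theorem IsBoundedCorrelation.nonneg (hB : IsBoundedCorrelation B b b') : 0 ≤ b :=
  (norm_nonneg _).trans (hB.bound 0 0)

theorem IsBoundedCorrelation.deriv_nonneg (hB : IsBoundedCorrelation B b b') : 0 ≤ b' :=
  le_trans (by positivity) (hB.deriv_bound 1 1 one_ne_zero one_ne_zero)

theorem norm_pairingSum_le (hB : IsBoundedCorrelation B b b') {k : ℕ} (τ : Fin k → ℝ) :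
    ‖pairingSum B τ‖ ≤ (pairings k).card * (1 + b) ^ k := by
  rw [← nsmul_eq_mul]
  refine (norm_sum_le_of_le _ fun σ _ => ?_).trans_eq (Finset.sum_const _)
  have hb := hB.nonneg
  -- The base `1 + b ≥ 1` lets the number of pairs be replaced by the cruder exponent `k`.
  refine (norm_prod_le_pow _ _ (β := 1 + b)
    (fun i _ => (hB.bound _ _).trans (by linarith))).trans ?_
  refine pow_le_pow_right₀ (by linarith) ?_
  simpa using Finset.card_filter_le (Finset.univ : Finset (Fin k)) fun i => i < σ i

theorem norm_pairingSum_sub_le (hB : IsBoundedCorrelation B b b') {k : ℕ} {τ τ' : Fin k → ℝ}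
    {δ : ℝ} (hδ : 0 ≤ δ) (hpos : ∀ i, 0 < τ i * τ' i) (hτ : ∀ i, |τ i - τ' i| ≤ δ) :
    ‖pairingSum B τ - pairingSum B τ'‖ ≤
      (pairings k).card * (k * (1 + b) ^ k * (2 * b' * δ)) := by
  rw [← nsmul_eq_mul, pairingSum, pairingSum, ← Finset.sum_sub_distrib]
  refine (norm_sum_le_of_le _ fun σ _ => ?_).trans_eq (Finset.sum_const _)
  have hb := hB.nonneg
  have hb' := hB.deriv_nonneg
  refine (norm_prod_sub_prod_le _ _ _ (β := 1 + b) (η := 2 * b' * δ) (by linarith)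
    (fun i _ => (hB.bound _ _).trans (by linarith))
    (fun i _ => (hB.bound _ _).trans (by linarith))
    (fun i _ => norm_sub_le_of_pos_mul hB (hpos _) (hpos _) (hτ _) (hτ _))).trans ?_
  have hc := Finset.card_filter_le (Finset.univ : Finset (Fin k)) fun i => i < σ i
  rw [Finset.card_univ, Fintype.card_fin] at hc
  gcongr
  linarith

theorem norm_influence_le (hB : IsBoundedCorrelation B b b') {m m' : ℕ} (t : Fin m → ℝ)
    (t' : Fin m' → ℝ) :
    ‖influence B t t'‖ ≤ (pairings (m + m')).card * (1 + b) ^ (m + m') :=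
  norm_pairingSum_le hB _

theorem norm_influence_sub_le (hB : IsBoundedCorrelation B b b') {m m' : ℕ} {s t : Fin m → ℝ}
    {s' t' : Fin m' → ℝ} {δ : ℝ} (hδ : 0 ≤ δ) (hs : ∀ i, 0 < s i) (ht : ∀ i, 0 < t i)
    (hs' : ∀ i, 0 < s' i) (ht' : ∀ i, 0 < t' i) (hst : ∀ i, |s i - t i| ≤ δ)
    (hst' : ∀ i, |s' i - t' i| ≤ δ) :
    ‖influence B s s' - influence B t t'‖ ≤
      (pairings (m + m')).card * ((m + m' : ℕ) * (1 + b) ^ (m + m') * (2 * b' * δ)) := by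
  refine norm_pairingSum_sub_le hB hδ (fun i => ?_) (fun i => ?_)
  · refine Fin.addCases (fun i => ?_) (fun i => ?_) i
    · simpa using mul_pos (hs i.rev) (ht i.rev)
    · simpa using mul_pos (hs' i) (ht' i)
  · refine Fin.addCases (fun i => ?_) (fun i => ?_) i
    · simpa [abs_sub_comm, neg_add_eq_sub] using hst i.rev
    · simpa using hst' i

end Influence

/-! ### Volume of the simplex and Riemann sums. -/

theorem measurableSet_simplex (m : ℕ) (t : ℝ) : MeasurableSet (simplex m t) := by
  have : simplex m t = (⋂ i, ⋂ j, ⋂ _ : i < j, {s : Fin m → ℝ | s i < s j}) ∩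
      Set.univ.pi fun _ => Set.Ioo 0 t := by
    ext s
    simp [simplex, StrictMono]
  rw [this]
  refine MeasurableSet.inter (MeasurableSet.iInter fun i => MeasurableSet.iInter fun j =>
    MeasurableSet.iInter fun _ => measurableSet_lt (measurable_pi_apply i) (measurable_pi_apply j))
    (MeasurableSet.univ_pi fun _ => measurableSet_Ioo)

/-- The `m!` images of the simplex under permutations of the coordinates are disjoint subsets of
a cube. -/
theorem volume_simplex_le (m : ℕ) {t : ℝ} (ht : 0 ≤ t) :
    volume (simplex m t) ≤ ENNReal.ofReal (t ^ m / m.factorial) := by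
  have hpre : ∀ σ : Equiv.Perm (Fin m),
      MeasurePreserving (fun s : Fin m → ℝ => s ∘ σ) volume volume := fun σ => by
    have h := volume_measurePreserving_piCongrLeft (fun _ : Fin m => ℝ) σ.symm
    convert h using 1
    funext s i
    obtain ⟨i, rfl⟩ := σ.symm.surjective i
    rw [MeasurableEquiv.coe_piCongrLeft, Equiv.piCongrLeft_apply_apply]
    simp
  let A : Equiv.Perm (Fin m) → Set (Fin m → ℝ) := fun σ => (fun s => s ∘ σ) ⁻¹' simplex m t
  have hvol : ∀ σ, volume (A σ) = volume (simplex m t) := fun σ =>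
    (hpre σ).measure_preimage (measurableSet_simplex m t).nullMeasurableSet
  have hmeas : ∀ σ, MeasurableSet (A σ) := fun σ =>
    (hpre σ).measurable (measurableSet_simplex m t)
  have hdisj : Pairwise (Function.onFun Disjoint A) := by
    intro σ τ hne
    refine Set.disjoint_left.2 fun s hs hs' => hne ?_
    have h1 : StrictMono (s ∘ σ) := hs.1
    have h2 : StrictMono (s ∘ τ) := hs'.1
    have hr : Set.range (s ∘ σ) = Set.range (s ∘ τ) := by
      rw [σ.surjective.range_comp, τ.surjective.range_comp]
    -- A strictly increasing enumeration is determined by its range.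
    have heq : s ∘ σ = s ∘ τ := (StrictMono.range_inj h1 h2).1 hr
    have hinj : Function.Injective s := by
      have := h1.injective
      rwa [← Function.Injective.of_comp_iff' s σ.bijective]
    ext i
    exact congrArg Fin.val (hinj (congrFun heq i))
  have hsub : (⋃ σ, A σ) ⊆ Set.univ.pi fun _ => Set.Ioo 0 t := by
    refine Set.iUnion_subset fun σ s hs i _ => ?_
    have := hs.2 (σ.symm i)
    simpa using this
  have hle := measure_mono (μ := volume) hsub
  rw [measure_iUnion hdisj hmeas, Real.volume_pi_Ioo, tsum_fintype] at hle
  simp only [hvol, Finset.sum_const, Finset.card_univ, Fintype.card_perm, Fintype.card_fin,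
    nsmul_eq_mul, sub_zero, Finset.prod_const] at hle
  rw [ENNReal.ofReal_div_of_pos (by positivity), ENNReal.ofReal_natCast,
    ENNReal.le_div_iff_mul_le (by simp [Nat.factorial_ne_zero]) (by simp), ENNReal.ofReal_pow ht,
    mul_comm]
  exact hle

/-- The error of a Riemann sum over disjoint cells of equal volume that need not exhaust the
domain. -/
theorem norm_sum_smul_sub_setIntegral_le {X G ι : Type*} [MeasurableSpace X]
    [NormedAddCommGroup G] [NormedSpace ℝ G] [CompleteSpace G] [Fintype ι] {μ : Measure X}
    {D : Set X} {Q : ι → Set X} {F : X → G} {c : ι → X} {v V A ε : ℝ}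
    (hF : IntegrableOn F D μ) (hQ : ∀ i, MeasurableSet (Q i))
    (hQD : ∀ i, Q i ⊆ D) (hdisj : Pairwise (Function.onFun Disjoint Q)) (hv : 0 ≤ v) (hV : 0 ≤ V)
    (hQv : ∀ i, μ (Q i) = ENNReal.ofReal v) (hDV : μ D ≤ ENNReal.ofReal V)
    (hε : ∀ i, ∀ x ∈ Q i, ‖F (c i) - F x‖ ≤ ε) (hA : 0 ≤ A) (hFA : ∀ x ∈ D, ‖F x‖ ≤ A) :
    ‖∑ i, v • F (c i) - ∫ x in D, F x ∂μ‖ ≤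
      Fintype.card ι * v * ε + A * (V - Fintype.card ι * v) := by
  have hUm : MeasurableSet (⋃ i, Q i) := MeasurableSet.iUnion hQ
  have hUD : (⋃ i, Q i) ⊆ D := Set.iUnion_subset hQD
  have hU : μ.real (⋃ i, Q i) = Fintype.card ι * v := by
    rw [measureReal_iUnion_fintype hdisj hQ (fun i => by rw [hQv]; exact ENNReal.ofReal_ne_top)]
    simp [Measure.real, hQv, hv]
  have hDfin : μ D ≠ ⊤ := ne_top_of_le_ne_top ENNReal.ofReal_ne_top hDV
  have hDr : μ.real D ≤ V := ENNReal.toReal_le_of_le_ofReal hV hDV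
  have hsplit : ∫ x in D, F x ∂μ = ∑ i, ∫ x in Q i, F x ∂μ + ∫ x in D \ ⋃ i, Q i, F x ∂μ := by
    rw [← integral_iUnion_fintype hQ hdisj (fun i => hF.mono_set (hQD i)),
      setIntegral_sdiff hUm hF hUD]
    abel
  have hcell : ∀ i, ‖v • F (c i) - ∫ x in Q i, F x ∂μ‖ ≤ v * ε := fun i => by
    have hlt : μ (Q i) < ⊤ := by rw [hQv]; exact ENNReal.ofReal_lt_top
    have hr : μ.real (Q i) = v := by simp [Measure.real, hQv, hv]
    have e : v • F (c i) - ∫ x in Q i, F x ∂μ = ∫ x in Q i, (F (c i) - F x) ∂μ := by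
      rw [integral_sub (integrableOn_const (C := F (c i)) hlt.ne) (hF.mono_set (hQD i)), setIntegral_const, hr]
    rw [e, mul_comm]
    exact (norm_setIntegral_le_of_norm_le_const hlt (hε i)).trans_eq (by rw [hr])
  have hrest : ‖∫ x in D \ ⋃ i, Q i, F x ∂μ‖ ≤ A * (V - Fintype.card ι * v) := by
    refine (norm_setIntegral_le_of_norm_le_const
      ((measure_mono Set.sdiff_subset).trans_lt hDfin.lt_top) (fun x hx => hFA x hx.1)).trans ?_
    rw [measureReal_sdiff hUD hUm, hU]
    gcongr
  rw [hsplit, ← sub_sub, ← Finset.sum_sub_distrib]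
  refine (norm_sub_le _ _).trans (add_le_add ?_ hrest)
  refine (norm_sum_le_of_le _ fun i _ => hcell i).trans_eq ?_
  simp [mul_assoc]

/-! ### Cells of the time grid. -/

/-- The product of the open time steps with index in `S`, in increasing order. -/
def cell {n m : ℕ} (Δt : ℝ) (S : Finset (Fin n)) (h : S.card = m) : Set (Fin m → ℝ) :=
  Set.univ.pi fun a =>
    Set.Ioo ((S.orderEmbOfFin h a : ℕ) * Δt) (((S.orderEmbOfFin h a : ℕ) + 1 : ℝ) * Δt)

section Cells

variable {n m : ℕ} {Δt : ℝ}

theorem measurableSet_cell (S : Finset (Fin n)) (h : S.card = m) :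
    MeasurableSet (cell Δt S h) :=
  MeasurableSet.univ_pi fun _ => measurableSet_Ioo

theorem volume_cell (hΔ : 0 < Δt) (S : Finset (Fin n)) (h : S.card = m) :
    volume (cell Δt S h) = ENNReal.ofReal (Δt ^ m) := by
  rw [cell, Real.volume_pi_Ioo, ENNReal.ofReal_pow hΔ.le]
  simp [add_mul]

theorem stepMid_mem_cell (hΔ : 0 < Δt) (S : Finset (Fin n)) (h : S.card = m) :
    stepMid Δt S h ∈ cell Δt S h := by
  intro a _
  constructor <;> · unfold stepMid; gcongr; linarith

theorem cell_subset_simplex (hΔ : 0 < Δt) (S : Finset (Fin n)) (h : S.card = m) :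
    cell Δt S h ⊆ simplex m (n * Δt) := by
  intro s hs
  refine ⟨fun a c hac => ?_, fun a => ?_⟩
  · have h1 := (hs a trivial).2
    have h2 := (hs c trivial).1
    have h3 : ((S.orderEmbOfFin h a : ℕ) + 1 : ℝ) ≤ (S.orderEmbOfFin h c : ℕ) := by
      have : (S.orderEmbOfFin h a : ℕ) < S.orderEmbOfFin h c := by simpa using hac
      exact_mod_cast this
    exact h1.trans_le ((mul_le_mul_of_nonneg_right h3 hΔ.le).trans h2.le)
  · have h1 := hs a trivial
    have h3 : ((S.orderEmbOfFin h a : ℕ) + 1 : ℝ) ≤ n := by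
      exact_mod_cast (S.orderEmbOfFin h a).is_lt
    exact ⟨lt_of_le_of_lt (by positivity) h1.1,
      h1.2.trans_le (mul_le_mul_of_nonneg_right h3 hΔ.le)⟩

theorem eq_of_mem_cell (hΔ : 0 < Δt) {S S' : Finset (Fin n)} (h : S.card = m) (h' : S'.card = m)
    {s : Fin m → ℝ} (hs : s ∈ cell Δt S h) (hs' : s ∈ cell Δt S' h') : S = S' := by
  have key : ∀ a, S.orderEmbOfFin h a = S'.orderEmbOfFin h' a := fun a => by
    have h1 := hs a trivial
    have h2 := hs' a trivial
    have h3 := lt_of_mul_lt_mul_right (h1.1.trans h2.2) hΔ.le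
    have h4 := lt_of_mul_lt_mul_right (h2.1.trans h1.2) hΔ.le
    norm_cast at h3 h4
    ext
    omega
  rw [← Finset.coe_inj, ← Finset.range_orderEmbOfFin S h, ← Finset.range_orderEmbOfFin S' h']
  congr 1
  exact funext key

theorem abs_stepMid_sub_le (S : Finset (Fin n)) (h : S.card = m)
    {s : Fin m → ℝ} (hs : s ∈ cell Δt S h) (a : Fin m) : |stepMid Δt S h a - s a| ≤ Δt := by
  have h1 := hs a trivial
  rw [Set.mem_Ioo] at h1
  unfold stepMid
  rw [abs_le]
  constructor <;> linarith

end Cells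

/-! ### The volume outside the cells. -/

/-- The left side counts `m`-tuples from `n` indices with a repetition: each has two equal entries,
leaving `m - 1` free choices for each pair of positions. -/
theorem pow_sub_descFactorial_le (n m : ℕ) :
    (n : ℝ) ^ m - n.descFactorial m ≤ m ^ 2 * (n : ℝ) ^ (m - 1) := by
  induction m with
  | zero => simp
  | succ m ih =>
    have hd : (n.descFactorial m : ℝ) ≤ (n : ℝ) ^ m := by
      exact_mod_cast Nat.descFactorial_le_pow n m
    have hs : (n : ℝ) * n.descFactorial m - m * n.descFactorial m ≤ n.descFactorial (m + 1) := by
      rw [Nat.descFactorial_succ]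
      rw [← sub_mul]
      push_cast
      gcongr
      rw [sub_le_iff_le_add]
      exact_mod_cast le_tsub_add
    -- At `m = 0` the truncated exponent is harmless because the factor `m ^ 2` vanishes.
    have h1 : (n : ℝ) * (m ^ 2 * (n : ℝ) ^ (m - 1)) ≤ m ^ 2 * (n : ℝ) ^ m := by
      rcases m with _ | m
      · simp
      · simp [pow_succ]; ring_nf; rfl
    have h2 : (m : ℝ) * n.descFactorial m ≤ m * (n : ℝ) ^ m := by gcongr
    have h3 := mul_le_mul_of_nonneg_left ih (Nat.cast_nonneg (α := ℝ) n)
    have h4 : 0 ≤ (n : ℝ) ^ m := by positivity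
    have h5 : 0 ≤ (m : ℝ) * (n : ℝ) ^ m := by positivity
    simp only [Nat.add_sub_cancel, Nat.cast_add, Nat.cast_one, pow_succ]
    nlinarith

/-- The part of a product of two simplices that is not covered by cells has volume `O(Δt)`. -/
theorem volume_sub_cells_le (n m m' : ℕ) {Δt : ℝ} (hΔ : 0 ≤ Δt) :
    (n * Δt) ^ m / m.factorial * ((n * Δt) ^ m' / m'.factorial)
        - (n.choose m * n.choose m' : ℕ) * (Δt ^ m * Δt ^ m') ≤
      ((m + m' : ℕ) ^ 2 * (n * Δt) ^ (m + m' - 1) / (m.factorial * m'.factorial)) * Δt := by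
  have h1 := pow_sub_descFactorial_le n m
  have h2 := pow_sub_descFactorial_le n m'
  have hd : (n.descFactorial m : ℝ) ≤ (n : ℝ) ^ m := by
    exact_mod_cast Nat.descFactorial_le_pow n m
  have e1 : (n.choose m : ℝ) = n.descFactorial m / m.factorial := by
    rw [Nat.descFactorial_eq_factorial_mul_choose]; push_cast; field_simp
  have e2 : (n.choose m' : ℝ) = n.descFactorial m' / m'.factorial := by
    rw [Nat.descFactorial_eq_factorial_mul_choose]; push_cast; field_simp
  have key : (n : ℝ) ^ m * (n : ℝ) ^ m' - n.descFactorial m * n.descFactorial m' ≤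
      (m + m' : ℕ) ^ 2 * (n : ℝ) ^ (m + m' - 1) := by
    have hA : ((n : ℝ) ^ m - n.descFactorial m) * (n : ℝ) ^ m' ≤
        m ^ 2 * (n : ℝ) ^ (m + m' - 1) := by
      refine (mul_le_mul_of_nonneg_right h1 (by positivity)).trans_eq ?_
      rcases m with _ | m
      · simp
      · rw [mul_assoc, ← pow_add]; congr 2; omega
    have hB : (n.descFactorial m : ℝ) * ((n : ℝ) ^ m' - n.descFactorial m') ≤
        m' ^ 2 * (n : ℝ) ^ (m + m' - 1) := by
      calc _ ≤ (n.descFactorial m : ℝ) * (m' ^ 2 * (n : ℝ) ^ (m' - 1)) := by gcongr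
        _ ≤ (n : ℝ) ^ m * (m' ^ 2 * (n : ℝ) ^ (m' - 1)) := by gcongr
        _ = _ := by
          rcases m' with _ | m'
          · simp
          · rw [mul_left_comm, ← pow_add]; congr 2
    -- The slack between `m ^ 2 + m' ^ 2` and `(m + m') ^ 2`.
    have hC : (0 : ℝ) ≤ 2 * m * m' * (n : ℝ) ^ (m + m' - 1) := by positivity
    push_cast
    nlinarith
  have hkey := mul_le_mul_of_nonneg_left key
    (show 0 ≤ Δt ^ (m + m') / (m.factorial * m'.factorial : ℝ) by positivity)
  calc _ = Δt ^ (m + m') / (m.factorial * m'.factorial : ℝ) *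
        ((n : ℝ) ^ m * (n : ℝ) ^ m' - n.descFactorial m * n.descFactorial m') := by
        push_cast; rw [e1, e2, pow_add, mul_pow, mul_pow]; field_simp
    _ ≤ _ := hkey
    _ = _ := by
      rcases Nat.eq_zero_or_pos (m + m') with h0 | h0
      · rw [h0]; simp
      · obtain ⟨k, hk⟩ := Nat.exists_eq_succ_of_ne_zero h0.ne'
        rw [hk]
        simp only [Nat.succ_eq_add_one, Nat.add_sub_cancel, mul_pow, pow_succ]
        ring

/-! ### Summability of the majorant. -/

/-- Write the term as `(1/2) ^ m * y` with `y = (2K) ^ m / √(m!)`; the sum of the two squares bounds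
it by a geometric plus an exponential series. -/
theorem summable_pow_div_sqrt_factorial (K : ℝ) :
    Summable fun m : ℕ => K ^ m / √(m.factorial : ℝ) := by
  refine Summable.of_norm_bounded (g := fun m : ℕ =>
    (1 / 4 : ℝ) ^ m + (4 * K ^ 2) ^ m / m.factorial) ?_ fun m => ?_
  · exact (summable_geometric_of_lt_one (by norm_num) (by norm_num)).add
      (Real.summable_pow_div_factorial _)
  · have hf : (0 : ℝ) < m.factorial := by positivity
    set y : ℝ := (2 * K) ^ m / √(m.factorial : ℝ) with hy
    have h1 : K ^ m / √(m.factorial : ℝ) = (1 / 2) ^ m * y := by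
      rw [hy, mul_div_assoc', ← mul_pow]; congr 2; ring
    have h2 : (4 * K ^ 2) ^ m / m.factorial = y ^ 2 := by
      rw [hy, div_pow, Real.sq_sqrt hf.le, ← pow_mul, mul_comm m 2, pow_mul]; congr 2; ring
    have h3 : (1 / 4 : ℝ) ^ m = ((1 / 2) ^ m) ^ 2 := by
      rw [← pow_mul, mul_comm m 2, pow_mul]; congr 1; norm_num
    rw [h1, h2, h3, Real.norm_eq_abs, abs_le]
    constructor <;> nlinarith [sq_nonneg ((1 / 2 : ℝ) ^ m + y), sq_nonneg ((1 / 2 : ℝ) ^ m - y),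
      sq_nonneg ((1 / 2 : ℝ) ^ m), sq_nonneg y]

/-- The majorant of the `(m, m')` term of the Dyson series. -/
def majorant (K : ℝ) (p : ℕ × ℕ) : ℝ :=
  (pairings (p.1 + p.2)).card * K ^ (p.1 + p.2) / (p.1.factorial * p.2.factorial)

/-- The pairing count cancels only the square root of `m! m'!`, up to a power of 2, so the majorant
is dominated by a product of two summable sequences. -/
theorem summable_majorant {K : ℝ} (hK : 0 ≤ K) : Summable (majorant K) := by
  have hs := summable_pow_div_sqrt_factorial (2 * K)
  have h0 : 0 ≤ fun m : ℕ => (2 * K) ^ m / √(m.factorial : ℝ) := fun m => by positivity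
  refine Summable.of_nonneg_of_le (fun p => by unfold majorant; positivity) (fun p => ?_)
    (hs.mul_of_nonneg hs h0 h0)
  obtain ⟨m, m'⟩ := p
  have hN : ((pairings (m + m')).card : ℝ) ≤
      2 ^ (m + m') * (√(m.factorial : ℝ) * √(m'.factorial : ℝ)) := by
    have h1 : ((pairings (m + m')).card : ℝ) ^ 2 ≤ (m + m').factorial := by
      exact_mod_cast card_pairings_sq_le (m + m')
    have h2 : ((m + m').factorial : ℝ) ≤ 2 ^ (m + m') * (m.factorial * m'.factorial) := by
      rw [← Nat.add_choose_mul_factorial_mul_factorial m m', mul_assoc]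
      push_cast
      gcongr
      exact_mod_cast Nat.choose_le_two_pow (m + m') m'
    have h3 : (2 : ℝ) ^ (m + m') ≤ (2 ^ (m + m')) ^ 2 :=
      le_self_pow₀ (one_le_pow₀ (by norm_num)) two_ne_zero
    refine (pow_le_pow_iff_left₀ (by positivity) (by positivity) two_ne_zero).1 ?_
    rw [mul_pow, mul_pow, Real.sq_sqrt (by positivity), Real.sq_sqrt (by positivity)]
    exact h1.trans (h2.trans (by gcongr))
  have e : ∀ m : ℕ, (m.factorial : ℝ) = √(m.factorial : ℝ) * √(m.factorial : ℝ) := fun m =>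
    (Real.mul_self_sqrt (by positivity)).symm
  have hp : ∀ m : ℕ, 0 < √(m.factorial : ℝ) := fun m => Real.sqrt_pos.2 (by positivity)
  have hm := hp m
  have hm' := hp m'
  unfold majorant
  calc _ ≤ 2 ^ (m + m') * (√(m.factorial : ℝ) * √(m'.factorial : ℝ)) * K ^ (m + m') /
        (m.factorial * m'.factorial) := by gcongr
    _ = _ := by
      simp only
      rw [e m, e m']
      simp only [Real.sqrt_mul_self hm.le, Real.sqrt_mul_self hm'.le]
      rw [pow_add, pow_add, mul_pow, mul_pow]
      field_simp

/-! ### Bounds for the Dyson terms. -/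

section Operators

variable {E : Type*} [NormedAddCommGroup E] [InnerProductSpace ℂ E] [CompleteSpace E]
  {H W : E →L[ℂ] E} {B : ℝ → ℝ → ℂ} {b b' : ℝ}

theorem norm_rightChain_le (hH : IsSelfAdjoint H) (hW : IsSelfAdjoint W) (m : ℕ) (t : ℝ)
    (s : Fin m → ℝ) : ‖rightChain H W m t s‖ ≤ ‖W‖ ^ m := by
  rw [rightChain_eq_star hH hW, norm_star]
  exact norm_leftChain_le hH W m t s

theorem norm_rightChain_sub_le (hH : IsSelfAdjoint H) (hW : IsSelfAdjoint W) (m : ℕ)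
    {δ t t' : ℝ} {s s' : Fin m → ℝ} (ht : |t - t'| ≤ δ) (hs : ∀ i, |s i - s' i| ≤ δ) :
    ‖rightChain H W m t s - rightChain H W m t' s'‖ ≤ ‖W‖ ^ m * (‖H‖ * (2 * m + 1) * δ) := by
  rw [rightChain_eq_star hH hW, rightChain_eq_star hH hW, ← star_sub, norm_star]
  exact norm_leftChain_sub_le hH W m ht hs

theorem norm_chains_le (hH : IsSelfAdjoint H) (hW : IsSelfAdjoint W) (ρ₀ : E →L[ℂ] E) (t : ℝ)
    {m m' : ℕ} (s : Fin m → ℝ) (s' : Fin m' → ℝ) :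
    ‖leftChain H W m t s * ρ₀ * rightChain H W m' t s'‖ ≤ ‖W‖ ^ (m + m') * ‖ρ₀‖ := by
  calc _ ≤ ‖leftChain H W m t s‖ * ‖ρ₀‖ * ‖rightChain H W m' t s'‖ := norm_mul₃_le
    _ ≤ ‖W‖ ^ m * ‖ρ₀‖ * ‖W‖ ^ m' := by
      gcongr
      · exact norm_leftChain_le hH W m t s
      · exact norm_rightChain_le hH hW m' t s'
    _ = _ := by ring

theorem norm_chains_sub_le (hH : IsSelfAdjoint H) (hW : IsSelfAdjoint W) (ρ₀ : E →L[ℂ] E) (t : ℝ)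
    {m m' : ℕ} {s u : Fin m → ℝ} {s' u' : Fin m' → ℝ} {δ : ℝ} (hδ : 0 ≤ δ)
    (hs : ∀ i, |s i - u i| ≤ δ) (hs' : ∀ i, |s' i - u' i| ≤ δ) :
    ‖leftChain H W m t s * ρ₀ * rightChain H W m' t s' -
        leftChain H W m t u * ρ₀ * rightChain H W m' t u'‖ ≤
      ‖W‖ ^ (m + m') * ‖ρ₀‖ * (2 * ‖H‖ * ((m + m' : ℕ) + 1) * δ) := by
  have ht : |t - t| ≤ δ := by simpa using hδ
  refine (norm_mul_sub_mul_le _ _ _ _).trans ?_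
  rw [← sub_mul]
  calc _ ≤ ‖leftChain H W m t s - leftChain H W m t u‖ * ‖ρ₀‖ * ‖rightChain H W m' t s'‖ +
        ‖leftChain H W m t u‖ * ‖ρ₀‖ * ‖rightChain H W m' t s' - rightChain H W m' t u'‖ := by
        gcongr <;> exact norm_mul_le _ _
    _ ≤ ‖W‖ ^ m * (‖H‖ * (2 * m + 1) * δ) * ‖ρ₀‖ * ‖W‖ ^ m' +
        ‖W‖ ^ m * ‖ρ₀‖ * (‖W‖ ^ m' * (‖H‖ * (2 * m' + 1) * δ)) := by
        gcongr
        · exact norm_leftChain_sub_le hH W m ht hs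
        · exact norm_rightChain_le hH hW m' t s'
        · exact norm_leftChain_le hH W m t u
        · exact norm_rightChain_sub_le hH hW m' ht hs'
    _ = _ := by push_cast; ring

theorem norm_dysonIntegrand_le (hH : IsSelfAdjoint H) (hW : IsSelfAdjoint W)
    (hB : IsBoundedCorrelation B b b') (ρ₀ : E →L[ℂ] E) (t : ℝ) (m m' : ℕ)
    (p : (Fin m → ℝ) × (Fin m' → ℝ)) :
    ‖dysonIntegrand H W ρ₀ B t m m' p‖ ≤
      (pairings (m + m')).card * ((1 + b) * ‖W‖) ^ (m + m') * ‖ρ₀‖ := by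
  have hb := hB.nonneg
  rw [dysonIntegrand, norm_smul]
  calc _ ≤ ((pairings (m + m')).card * (1 + b) ^ (m + m')) * (‖W‖ ^ (m + m') * ‖ρ₀‖) := by
        gcongr
        · exact norm_influence_le hB _ _
        · exact norm_chains_le hH hW ρ₀ t _ _
    _ = _ := by rw [mul_pow]; ring

theorem norm_dysonIntegrand_sub_le (hH : IsSelfAdjoint H) (hW : IsSelfAdjoint W)
    (hB : IsBoundedCorrelation B b b') (ρ₀ : E →L[ℂ] E) {t : ℝ} {m m' : ℕ}
    {p q : (Fin m → ℝ) × (Fin m' → ℝ)} (hp : p ∈ simplex m t ×ˢ simplex m' t)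
    (hq : q ∈ simplex m t ×ˢ simplex m' t) {δ : ℝ} (hδ : 0 ≤ δ)
    (h1 : ∀ i, |p.1 i - q.1 i| ≤ δ) (h2 : ∀ i, |p.2 i - q.2 i| ≤ δ) :
    ‖dysonIntegrand H W ρ₀ B t m m' p - dysonIntegrand H W ρ₀ B t m m' q‖ ≤
      (pairings (m + m')).card * ((1 + b) * ‖W‖) ^ (m + m') * ‖ρ₀‖ *
        ((2 * b' + 2 * ‖H‖) * ((m + m' : ℕ) + 1)) * δ := by
  have hb := hB.nonneg
  have hb' := hB.deriv_nonneg
  have e : ∀ (x y : ℂ) (X Y : E →L[ℂ] E), x • X - y • Y = (x - y) • X + y • (X - Y) :=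
    fun x y X Y => by module
  rw [dysonIntegrand, dysonIntegrand, e]
  refine (norm_add_le _ _).trans ?_
  rw [norm_smul, norm_smul]
  calc _ ≤ (pairings (m + m')).card * ((m + m' : ℕ) * (1 + b) ^ (m + m') * (2 * b' * δ)) *
          (‖W‖ ^ (m + m') * ‖ρ₀‖) +
        ((pairings (m + m')).card * (1 + b) ^ (m + m')) *
          (‖W‖ ^ (m + m') * ‖ρ₀‖ * (2 * ‖H‖ * ((m + m' : ℕ) + 1) * δ)) := by
        gcongr
        · exact norm_influence_sub_le hB hδ (fun i => (hp.1.2 i).1) (fun i => (hq.1.2 i).1)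
            (fun i => (hp.2.2 i).1) (fun i => (hq.2.2 i).1) h1 h2
        · exact norm_chains_le hH hW ρ₀ t _ _
        · exact norm_influence_le hB _ _
        · exact norm_chains_sub_le hH hW ρ₀ t hδ h1 h2
    _ ≤ (pairings (m + m')).card * (((m + m' : ℕ) + 1) * (1 + b) ^ (m + m') * (2 * b' * δ)) *
          (‖W‖ ^ (m + m') * ‖ρ₀‖) +
        ((pairings (m + m')).card * (1 + b) ^ (m + m')) *
          (‖W‖ ^ (m + m') * ‖ρ₀‖ * (2 * ‖H‖ * ((m + m' : ℕ) + 1) * δ)) := by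
        gcongr
        linarith
    _ = _ := by rw [mul_pow]; ring

theorem volume_simplex_prod_le (m m' : ℕ) {t : ℝ} (ht : 0 ≤ t) :
    volume (simplex m t ×ˢ simplex m' t) ≤
      ENNReal.ofReal (t ^ m / m.factorial * (t ^ m' / m'.factorial)) := by
  rw [Measure.volume_eq_prod, Measure.prod_prod, ENNReal.ofReal_mul (by positivity)]
  gcongr
  · exact volume_simplex_le m ht
  · exact volume_simplex_le m' ht

/-- Measurability comes from the Lipschitz estimate on the open domain; no measurability of `B` is
assumed. -/
theorem integrableOn_dysonIntegrand (hH : IsSelfAdjoint H) (hW : IsSelfAdjoint W)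
    (hB : IsBoundedCorrelation B b b') (ρ₀ : E →L[ℂ] E) {t : ℝ} (ht : 0 ≤ t) (m m' : ℕ) :
    IntegrableOn (dysonIntegrand H W ρ₀ B t m m') (simplex m t ×ˢ simplex m' t) := by
  have hb := hB.nonneg
  have hb' := hB.deriv_nonneg
  have hcont : ContinuousOn (dysonIntegrand H W ρ₀ B t m m') (simplex m t ×ˢ simplex m' t) := by
    have hK : (0 : ℝ) ≤ (pairings (m + m')).card * ((1 + b) * ‖W‖) ^ (m + m') * ‖ρ₀‖ *
        ((2 * b' + 2 * ‖H‖) * ((m + m' : ℕ) + 1)) := by positivity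
    refine (LipschitzOnWith.of_dist_le_mul (K := ⟨_, hK⟩) fun p hp q hq => ?_).continuousOn
    rw [dist_eq_norm]
    refine norm_dysonIntegrand_sub_le hH hW hB ρ₀ hp hq dist_nonneg (fun i => ?_) (fun i => ?_)
    · rw [← Real.dist_eq]
      exact (dist_le_pi_dist p.1 q.1 i).trans (le_max_left _ _)
    · rw [← Real.dist_eq]
      exact (dist_le_pi_dist p.2 q.2 i).trans (le_max_right _ _)
  have hD : MeasurableSet (simplex m t ×ˢ simplex m' t) :=
    (measurableSet_simplex m t).prod (measurableSet_simplex m' t)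
  exact IntegrableOn.of_bound
    ((volume_simplex_prod_le m m' ht).trans_lt ENNReal.ofReal_lt_top)
    (hcont.aestronglyMeasurable hD) _
    (ae_of_all _ fun p => norm_dysonIntegrand_le hH hW hB ρ₀ t m m' p)

theorem norm_phase (m m' : ℕ) : ‖(-Complex.I) ^ m * Complex.I ^ m'‖ = 1 := by simp

theorem norm_dysonTerm_le (hH : IsSelfAdjoint H) (hW : IsSelfAdjoint W)
    (hB : IsBoundedCorrelation B b b') (ρ₀ : E →L[ℂ] E) {t : ℝ} (ht : 0 ≤ t) (m m' : ℕ) :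
    ‖dysonTerm H W ρ₀ B t m m'‖ ≤ ‖ρ₀‖ * majorant ((1 + b) * ‖W‖ * t) (m, m') := by
  have hb := hB.nonneg
  have hv := volume_simplex_prod_le m m' ht
  rw [dysonTerm, norm_smul, norm_phase, one_mul]
  refine (norm_setIntegral_le_of_norm_le_const (hv.trans_lt ENNReal.ofReal_lt_top)
    fun p _ => norm_dysonIntegrand_le hH hW hB ρ₀ t m m' p).trans ?_
  calc _ ≤ (pairings (m + m')).card * ((1 + b) * ‖W‖) ^ (m + m') * ‖ρ₀‖ *
        (t ^ m / m.factorial * (t ^ m' / m'.factorial)) := by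
        gcongr
        exact ENNReal.toReal_le_of_le_ofReal (by positivity) hv
    _ = _ := by
      simp only [majorant]
      rw [mul_pow _ t, pow_add t]
      field_simp

theorem summable_dysonTerm (hH : IsSelfAdjoint H) (hW : IsSelfAdjoint W)
    (hB : IsBoundedCorrelation B b b') (ρ₀ : E →L[ℂ] E) {t : ℝ} (ht : 0 ≤ t) :
    Summable fun p : ℕ × ℕ => dysonTerm H W ρ₀ B t p.1 p.2 := by
  have hb := hB.nonneg
  exact Summable.of_norm_bounded ((summable_majorant (by positivity)).mul_left ‖ρ₀‖)
    fun p => norm_dysonTerm_le hH hW hB ρ₀ ht p.1 p.2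

/-! ### The discrete density as a Riemann sum, and its error. -/

/-- The part of the discrete density in which `m` left and `m'` right steps are coupled. -/
def discreteTerm (H W ρ₀ : E →L[ℂ] E) (B : ℝ → ℝ → ℂ) (Δt : ℝ) (n m m' : ℕ) : E →L[ℂ] E :=
  ((-Complex.I) ^ m * Complex.I ^ m') •
    ∑ i : {S : Finset (Fin n) // S.card = m} × {S : Finset (Fin n) // S.card = m'},
      (Δt ^ m * Δt ^ m') • dysonIntegrand H W ρ₀ B (n * Δt) m m'
        (stepMid Δt i.1.1 i.1.2, stepMid Δt i.2.1 i.2.2)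

theorem bijective_ones (n : ℕ) : Function.Bijective (ones : (Fin n → Fin 2) → Finset (Fin n)) := by
  constructor
  · intro j j' h
    funext k
    have h1 : k ∈ ones j ↔ k ∈ ones j' := by rw [h]
    simp only [ones, Finset.mem_filter, Finset.mem_univ, true_and] at h1
    omega
  · intro S
    refine ⟨fun k => if k ∈ S then 1 else 0, ?_⟩
    ext k
    simp [ones]

theorem sum_finset_eq_sum_card {n : ℕ} {G : Type*} [AddCommMonoid G] (f : Finset (Fin n) → G) :
    ∑ S, f S = ∑ m ∈ Finset.range (n + 1), ∑ S : {S : Finset (Fin n) // S.card = m}, f S := by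
  rw [← Finset.sum_fiberwise_of_maps_to (g := Finset.card) (t := Finset.range (n + 1))
    (fun S _ => by simpa [Nat.lt_succ_iff] using S.card_le_univ)]
  refine Finset.sum_congr rfl fun m _ => ?_
  exact (Finset.sum_subtype _ (by simp) _)

theorem discreteDensity_eq_sum (hH : IsSelfAdjoint H) (hW : IsSelfAdjoint W) (ρ₀ : E →L[ℂ] E)
    (B : ℝ → ℝ → ℂ) (Δt : ℝ) (n : ℕ) :
    discreteDensity H W ρ₀ B Δt n =
      ∑ p ∈ Finset.range (n + 1) ×ˢ Finset.range (n + 1),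
        discreteTerm H W ρ₀ B Δt n p.1 p.2 := by
  let f : Finset (Fin n) → Finset (Fin n) → E →L[ℂ] E := fun S S' =>
    ((-Complex.I) ^ S.card * Complex.I ^ S'.card) • (Δt ^ S.card * Δt ^ S'.card) •
      dysonIntegrand H W ρ₀ B (n * Δt) S.card S'.card (stepMid Δt S rfl, stepMid Δt S' rfl)
  have h1 : discreteDensity H W ρ₀ B Δt n =
      ∑ j : Fin n → Fin 2, ∑ j' : Fin n → Fin 2, f (ones j) (ones j') := by
    refine Finset.sum_congr rfl fun j _ => Finset.sum_congr rfl fun j' _ => ?_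
    rw [prod_stepOp_eq_leftChain, prod_star_stepOp_eq_rightChain hH hW]
    -- `midTimes` unfolds to `stepMid` at the set `ones j`.
    change influence B (stepMid Δt (ones j) rfl) (stepMid Δt (ones j') rfl) • _ = _
    simp only [f, dysonIntegrand, smul_mul_assoc, mul_smul_comm]
    simp only [← Complex.coe_smul, smul_smul]
    congr 1
    push_cast
    rw [← neg_mul, mul_pow, mul_pow]
    ring
  have h2 : ∑ j : Fin n → Fin 2, ∑ j' : Fin n → Fin 2, f (ones j) (ones j') =
      ∑ S, ∑ S', f S S' := by
    rw [← (bijective_ones n).sum_comp fun S => ∑ S', f S S']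
    exact Finset.sum_congr rfl fun j _ => (bijective_ones n).sum_comp (f (ones j))
  rw [h1, h2, sum_finset_eq_sum_card, Finset.sum_product]
  refine Finset.sum_congr rfl fun m _ => ?_
  simp_rw [sum_finset_eq_sum_card (f _)]
  rw [Finset.sum_comm]
  refine Finset.sum_congr rfl fun m' _ => ?_
  rw [discreteTerm, Finset.smul_sum, Fintype.sum_prod_type]
  refine Finset.sum_congr rfl fun S _ => Finset.sum_congr rfl fun S' _ => ?_
  obtain ⟨S, rfl⟩ := S
  obtain ⟨S', rfl⟩ := S'
  rfl

theorem discreteTerm_eq_zero (H W ρ₀ : E →L[ℂ] E) (B : ℝ → ℝ → ℂ) (Δt : ℝ) {n m m' : ℕ}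
    (h : n < m ∨ n < m') : discreteTerm H W ρ₀ B Δt n m m' = 0 := by
  rw [discreteTerm, Finset.sum_eq_zero, smul_zero]
  rintro ⟨⟨S, rfl⟩, ⟨S', rfl⟩⟩ _
  have h1 := S.card_le_univ
  have h2 := S'.card_le_univ
  rw [Fintype.card_fin] at h1 h2
  omega

/-- Adds the oscillation within cells to the contribution of the uncovered volume. It includes
orders above `n`, where there are no cells, so the tail of the series needs no separate estimate. -/
theorem norm_discreteTerm_sub_dysonTerm_le (hH : IsSelfAdjoint H) (hW : IsSelfAdjoint W)
    (hB : IsBoundedCorrelation B b b') (ρ₀ : E →L[ℂ] E) {Δt : ℝ} (hΔ : 0 < Δt) (n m m' : ℕ) :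
    ‖discreteTerm H W ρ₀ B Δt n m m' - dysonTerm H W ρ₀ B (n * Δt) m m'‖ ≤
      ‖ρ₀‖ * (2 * b' + 2 * ‖H‖ + 1) *
        majorant (4 * ((1 + b) * ‖W‖) * (1 + n * Δt)) (m, m') * Δt := by
  have hb := hB.nonneg
  have hb' := hB.deriv_nonneg
  have hT : 0 ≤ n * Δt := by positivity
  have hA : (0 : ℝ) ≤ (pairings (m + m')).card * ((1 + b) * ‖W‖) ^ (m + m') * ‖ρ₀‖ := by positivity
  rw [discreteTerm, dysonTerm, ← smul_sub, norm_smul, norm_phase, one_mul]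
  refine (norm_sum_smul_sub_setIntegral_le
    (Q := fun i : {S : Finset (Fin n) // S.card = m} × {S : Finset (Fin n) // S.card = m'} =>
      cell Δt i.1.1 i.1.2 ×ˢ cell Δt i.2.1 i.2.2)
    (integrableOn_dysonIntegrand hH hW hB ρ₀ hT m m')
    (fun i => (measurableSet_cell _ _).prod (measurableSet_cell _ _))
    (fun i => Set.prod_mono (cell_subset_simplex hΔ _ _) (cell_subset_simplex hΔ _ _))
    ?_ (by positivity) (by positivity) (fun i => ?_) (volume_simplex_prod_le m m' hT)
    (fun i x hx => norm_dysonIntegrand_sub_le hH hW hB ρ₀ ?_ ?_ hΔ.le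
      (abs_stepMid_sub_le _ _ hx.1) (abs_stepMid_sub_le _ _ hx.2))
    hA (fun x _ => norm_dysonIntegrand_le hH hW hB ρ₀ _ m m' x)).trans ?_
  · intro i i' hne
    refine Set.disjoint_left.2 fun x hx hx' => hne ?_
    exact Prod.ext (Subtype.ext (eq_of_mem_cell hΔ _ _ hx.1 hx'.1))
      (Subtype.ext (eq_of_mem_cell hΔ _ _ hx.2 hx'.2))
  · rw [Measure.volume_eq_prod, Measure.prod_prod, volume_cell hΔ, volume_cell hΔ,
      ← ENNReal.ofReal_mul (by positivity)]
  · exact ⟨cell_subset_simplex hΔ _ _ (stepMid_mem_cell hΔ _ _),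
      cell_subset_simplex hΔ _ _ (stepMid_mem_cell hΔ _ _)⟩
  · exact ⟨cell_subset_simplex hΔ _ _ hx.1, cell_subset_simplex hΔ _ _ hx.2⟩
  rw [Fintype.card_prod, Fintype.card_finset_len, Fintype.card_finset_len, Fintype.card_fin]
  have hrest := volume_sub_cells_le n m m' hΔ.le
  have hcover : ((n.choose m * n.choose m' : ℕ) : ℝ) * (Δt ^ m * Δt ^ m') ≤
      (n * Δt) ^ (m + m') / (m.factorial * m'.factorial) := by
    have h1 : (n.choose m : ℝ) ≤ (n : ℝ) ^ m / m.factorial := Nat.choose_le_pow_div m n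
    have h2 : (n.choose m' : ℝ) ≤ (n : ℝ) ^ m' / m'.factorial := Nat.choose_le_pow_div m' n
    push_cast
    calc _ ≤ ((n : ℝ) ^ m / m.factorial * ((n : ℝ) ^ m' / m'.factorial)) *
          (Δt ^ m * Δt ^ m') := by gcongr
      _ = _ := by rw [mul_pow, pow_add, pow_add]; field_simp
  set A : ℝ := (pairings (m + m')).card * ((1 + b) * ‖W‖) ^ (m + m') * ‖ρ₀‖ with hAdef
  set M : ℕ := m + m'
  set T : ℝ := n * Δt
  set c : ℝ := m.factorial * m'.factorial with hc
  have hc0 : 0 < c := by positivity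
  -- This is the source of the 4 in the argument of `majorant`.
  have hM : ((M : ℝ) + 1) ^ 2 ≤ 4 ^ M := by
    have : ((M : ℝ) + 1) ≤ 2 ^ M := by exact_mod_cast Nat.lt_two_pow_self (n := M)
    calc _ ≤ ((2 : ℝ) ^ M) ^ 2 := by gcongr
      _ = 4 ^ M := by rw [← pow_mul, mul_comm, pow_mul]; norm_num
  have hT1 : T ^ M ≤ (1 + T) ^ M := by gcongr; linarith
  -- Since `T` may be below 1, raising the exponent requires the base `1 + T`.
  have hT2 : T ^ (M - 1) ≤ (1 + T) ^ M :=
    (pow_le_pow_left₀ hT (by linarith) _).trans (pow_le_pow_right₀ (by linarith) (by omega))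
  calc _ ≤ T ^ M / c * (A * ((2 * b' + 2 * ‖H‖) * ((M : ℝ) + 1)) * Δt) +
        A * ((M ^ 2 * T ^ (M - 1) / c) * Δt) := by gcongr
    _ ≤ (1 + T) ^ M / c * (A * ((2 * b' + 2 * ‖H‖) * ((M : ℝ) + 1) ^ 2) * Δt) +
        A * ((((M : ℝ) + 1) ^ 2 * (1 + T) ^ M / c) * Δt) := by
        gcongr
        · exact le_self_pow₀ (by linarith [Nat.cast_nonneg (α := ℝ) M]) two_ne_zero
        · linarith
    _ = A * (1 + T) ^ M / c * (2 * b' + 2 * ‖H‖ + 1) * ((M : ℝ) + 1) ^ 2 * Δt := by ring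
    _ ≤ A * (1 + T) ^ M / c * (2 * b' + 2 * ‖H‖ + 1) * 4 ^ M * Δt := by gcongr
    _ = _ := by
      simp only [majorant]
      rw [mul_pow _ (1 + T), mul_pow 4, hAdef, hc]
      ring

end Operators

end OpenDyson

end

open OpenDyson
theorem mainTheorem2 :
    ∃ C : ℝ → ℝ → ℝ → ℝ → ℝ → ℝ → ℝ,
      ∀ (E : Type*) [NormedAddCommGroup E] [InnerProductSpace ℂ E] [CompleteSpace E]
        (H W ρ₀ : E →L[ℂ] E) (B : ℝ → ℝ → ℂ) (b b' : ℝ),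
        IsSelfAdjoint H → IsSelfAdjoint W → IsBoundedCorrelation B b b' →
        ∀ (n : ℕ) (Δt : ℝ), 0 < Δt →
          (∀ m m' : ℕ, IntegrableOn (dysonIntegrand H W ρ₀ B (n * Δt) m m')
            (simplex m (n * Δt) ×ˢ simplex m' (n * Δt))) ∧
          Summable (fun p : ℕ × ℕ => dysonTerm H W ρ₀ B (n * Δt) p.1 p.2) ∧
          ‖discreteDensity H W ρ₀ B Δt n - reducedDensity H W ρ₀ B (n * Δt)‖ ≤
            C ‖H‖ ‖ρ₀‖ ‖W‖ b b' (n * Δt) * Δt := by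
  refine ⟨fun h r w b b' T => r * (2 * b' + 2 * h + 1) *
    ∑' p, majorant (4 * ((1 + b) * w) * (1 + T)) p, ?_⟩
  intro E _ _ _ H W ρ₀ B b b' hH hW hB n Δt hΔ
  have hb := hB.nonneg
  have hT : 0 ≤ n * Δt := by positivity
  have hsum := summable_dysonTerm hH hW hB ρ₀ hT
  refine ⟨fun m m' => integrableOn_dysonIntegrand hH hW hB ρ₀ hT m m', hsum, ?_⟩
  -- Extended by its vanishing terms, the finite sum runs over the same index set as the Dyson
  -- series, so the two can be subtracted termwise.
  have hdisc : HasSum (fun p : ℕ × ℕ => discreteTerm H W ρ₀ B Δt n p.1 p.2)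
      (discreteDensity H W ρ₀ B Δt n) := by
    rw [discreteDensity_eq_sum hH hW]
    refine hasSum_sum_of_ne_finset_zero fun p hp => discreteTerm_eq_zero H W ρ₀ B Δt ?_
    rw [Finset.mem_product, Finset.mem_range, Finset.mem_range] at hp
    omega
  have hred : HasSum (fun p : ℕ × ℕ => dysonTerm H W ρ₀ B (n * Δt) p.1 p.2)
      (reducedDensity H W ρ₀ B (n * Δt)) := by
    -- Unconditional summability identifies the iterated sum with the sum over pairs.
    rw [reducedDensity, ← hsum.tsum_prod]
    exact hsum.hasSum
  rw [← (hdisc.sub hred).tsum_eq]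
  have hmaj := (summable_majorant
    (show 0 ≤ 4 * ((1 + b) * ‖W‖) * (1 + n * Δt) by positivity)).hasSum
  exact tsum_of_norm_bounded ((hmaj.mul_left _).mul_right Δt)
    fun p => norm_discreteTerm_sub_dysonTerm_le hH hW hB ρ₀ hΔ n p.1 p.2
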